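/- A turn sequence is a finite word $\sigma=\sigma_1\cdots\sigma_n$ with $\sigma_i\in\{\mathtt L,\mathtt R\}$. A chain realizing $\sigma$ is a simple (not self-intersecting) rectilinear path in the plane that starts at the origin $o$, consists of $n+1$ axis-parallel segments of positive integral length, the first of which heads east, and makes the left ($\mathtt L$) and right ($\mathtt R$) $90^\circ$ turns $\sigma_1,\dots,\sigma_n$ in this order. A point is reachable by $\sigma$ if it is the endpoint of a chain realizing $\sigma$. If $\sigma$ can reach a point of the negative $x$-axis $\{(-a,0): a\ge 1\}$, let $(x^-_\sigma,0)$ be the reachable point on it that is closest to $o$. For integers $l,r\ge 0$, let $x^-_{l,r}$ be the maximum of $|x^-_\sigma|$ over all turn sequences $\sigma$ with $l$ left and $r$ right turns for which $x^-_\sigma$ exists. Theorem. Let $l-r\ge 0$ and let $\sigma=\sigma_1\cdots\sigma_n$ be any turn sequence with $l$ left and $r$ right turns that can reach the negative $x$-axis. Then $|x^-_\sigma|\ge B$, and hence $x^-_{l,r}\ge B$, where $$B=\begin{cases} \left|\left\lfloor\frac{l-r+2}{4}\right\rfloor-1\right|+1 & \text{if } l-r\equiv 0 \text{ or } 1 \pmod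 4,\\[2pt] \left|\left\lfloor\frac{l-r+2}{4}\right\rfloor-2\right|+2 & \text{if } l-r\equiv 2 \pmod 4 \text{ and } \sigma_n=\mathtt L,\\[2pt] \left\lfloor\frac{l-r+2}{4}\right\rfloor+1 & \text{if } l-r\equiv 2 \pmod 4 \text{ and } \sigma_n=\mathtt R,\\[2pt] \left\lfloor\frac{l-r+2}{4}\right\rfloor & \text{if } l-r\equiv 3 \pmod 4. \end{cases}$$ -/

import Mathlib

/-- A turn: left or right. A turn sequence `σ₁ σ₂ ⋯ σₙ` is a `List Turn`. -/
inductive Turn where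
  | L : Turn
  | R : Turn
  deriving DecidableEq

namespace Turn

/-- The direction obtained from direction `d` by a turn: the rotation of `d` by `90°`,
counterclockwise for a left turn and clockwise for a right turn. -/
def rotate (d : ℤ × ℤ) : Turn → ℤ × ℤ
  | L => (-d.2, d.1)
  | R => (d.2, -d.1)

end Turn

/-- The direction of the segment number `i` (`0 ≤ i ≤ n`) of a chain with turn sequence `σ`: the
first segment (number `0`) heads to the east, and segment `i` comes after the first `i` turns. -/
def segmentDir (σ : List Turn) (i : ℕ) : ℤ × ℤ :=
  (σ.take i).foldl Turn.rotate (1, 0)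

/-- The lattice point `p` as a point of the real plane. -/
def toPlane (p : ℤ × ℤ) : ℝ × ℝ := ((p.1 : ℝ), (p.2 : ℝ))

/-- The closed segment number `i` of the chain with vertices `v 0, v 1, v 2, …`, as a subset of
the real plane. -/
def chainSegment (v : ℕ → ℤ × ℤ) (i : ℕ) : Set (ℝ × ℝ) :=
  segment ℝ (toPlane (v i)) (toPlane (v (i + 1)))

/-- The rectilinear chain with vertices `v 0, …, v (n + 1)` (where `n = σ.length`; the values of `v`
beyond `n + 1` are irrelevant) realizes the turn sequence `σ`: it starts at the origin, its `n + 1`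
segments have positive integral lengths, the first one heads east and consecutive ones make the
turns of `σ` in order, and the chain has no self-intersection, i.e. two different segments have a
point in common only if they are consecutive, and then only their common vertex. -/
structure Realizes (σ : List Turn) (v : ℕ → ℤ × ℤ) : Prop where
  start : v 0 = (0, 0)
  step : ∀ i ≤ σ.length, ∃ len : ℕ, 0 < len ∧ v (i + 1) = v i + len • segmentDir σ i
  simple : ∀ i j : ℕ, i < j → j ≤ σ.length →
    ∀ q ∈ chainSegment v i ∩ chainSegment v j, j = i + 1 ∧ q = toPlane (v j)

/-- The set `A(σ)` of lattice points reachable by `σ`: the endpoints of the chains realizing `σ`. -/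
def reachableSet (σ : List Turn) : Set (ℤ × ℤ) :=
  {p | ∃ v : ℕ → ℤ × ℤ, Realizes σ v ∧ v (σ.length + 1) = p}

/-- The distances from the origin of the points on the (open) negative `x`-axis that are reachable
by `σ`. -/
def negXDistances (σ : List Turn) : Set ℕ :=
  {a | 0 < a ∧ (-(a : ℤ), (0 : ℤ)) ∈ reachableSet σ}

/-- `σ` can reach the negative `x`-axis. -/
def ReachesNegX (σ : List Turn) : Prop := (negXDistances σ).Nonempty

/-- `|x⁻_σ|`: the distance from the origin to the closest point of the negative `x`-axis reachable
by `σ`. It is meaningful when `ReachesNegX σ`. -/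
noncomputable def xMinus (σ : List Turn) : ℕ := sInf (negXDistances σ)

/-- `x⁻_{l,r}`: the maximum of `|x⁻_σ|` over the turn sequences `σ` with `l` left and `r` right
turns for which `x⁻_σ` exists. (There are only finitely many such sequences.) -/
noncomputable def xMinusMax (l r : ℕ) : ℕ :=
  sSup {a | ∃ σ : List Turn, σ.count Turn.L = l ∧ σ.count Turn.R = r ∧ ReachesNegX σ ∧
    a = xMinus σ}

/-! A chain is refined to a self-avoiding walk of unit steps. Its total turning, in quarter turns,
is the number of left turns minus the number of right turns, say `t`. The theorem thus reduces to
bounding how far a self-avoiding walk can turn when it ends at distance `a` west of its start.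

If the walk avoids the points between its two ends, an eastward segment closes it to a simple
lattice polygon, whose turning is `±4` (`IsLatticePolygon.turning_eq`, a discrete form of Hopf's
proof of the Umlaufsatz). So its turning is `±4` up to corrections from its first and last steps. In
general, cut the walk at its visited point nearest to the start on the ray going west. Each piece
between successive cuts contributes at most `4`, and there are at most `a` pieces; hence `t ≤ 4a` up
to end corrections (`IsLatticePath.turning_le`).

The residue of `t` mod `4` fixes the last direction and hence the correction. At distance `1` the
exact values `±4` exclude `t = 0` and `t = 1`, which explains the absolute values in the bound. For
`t ≡ 2` the last segment heads west along the axis; deleting it leaves a chain ending strictly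
closer, with `t` changed by one according to the last turn (`Realizes.exists_lt_of_last_west`). -/

/-- One of the four unit vectors of the lattice `ℤ × ℤ`. -/
def IsUnitStep (u : ℤ × ℤ) : Prop :=
  u = (1, 0) ∨ u = (0, 1) ∨ u = (-1, 0) ∨ u = (0, -1)

/-- The cross product; for unit steps it is `1` for a left turn, `-1` for a right turn. -/
def crossTurn (u v : ℤ × ℤ) : ℤ := u.1 * v.2 - u.2 * v.1

/-- The step number `i` of a lattice walk. -/
def stepVec (w : ℕ → ℤ × ℤ) (i : ℕ) : ℤ × ℤ := w (i + 1) - w i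

/-- The total turning of a lattice walk at its vertices `1, …, n`. -/
def turning (w : ℕ → ℤ × ℤ) (n : ℕ) : ℤ :=
  ∑ i ∈ Finset.range n, crossTurn (stepVec w i) (stepVec w (i + 1))

/-! ### Octants of lattice vectors -/

/-- The direction of a nonzero vector, rounded to one of the four half-axes (even values) and the
four open quadrants (odd values), counterclockwise from the east. -/
def octant (p : ℤ × ℤ) : ℤ :=
  if 0 < p.2 then (if 0 < p.1 then 1 else if p.1 = 0 then 2 else 3)
  else if p.2 < 0 then (if p.1 < 0 then 5 else if p.1 = 0 then 6 else 7)
  else if p.1 < 0 then 4 else 0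

/-- The difference of the octants of two vectors, reduced modulo `8` to `[-4, 4]`. -/
def octantDiff (p q : ℤ × ℤ) : ℤ :=
  if 4 < octant q - octant p then octant q - octant p - 8
  else if octant q - octant p < -4 then octant q - octant p + 8
  else octant q - octant p

theorem octantDiff_eq_add_mul (p q : ℤ × ℤ) :
    ∃ k : ℤ, octantDiff p q = octant q - octant p + 8 * k := by
  unfold octantDiff
  split_ifs
  · exact ⟨-1, by ring⟩
  · exact ⟨1, by ring⟩
  · exact ⟨0, by ring⟩

/-- A unit step between nonzero lattice points cannot cross a half-axis without landing on it, so it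
leads to the same or a neighbouring octant. -/
theorem octantDiff_bound {p q : ℤ × ℤ} (hp : p ≠ 0) (hq : q ≠ 0)
    (h : IsUnitStep (q - p)) : -1 ≤ octantDiff p q ∧ octantDiff p q ≤ 1 := by
  obtain ⟨x, y⟩ := p
  obtain ⟨x', y'⟩ := q
  simp only [ne_eq, Prod.mk_eq_zero, not_and_or] at hp hq
  simp only [IsUnitStep, Prod.mk_sub_mk, Prod.mk.injEq] at h
  have key : octant (x', y') - octant (x, y) ∈ ({-7, -1, 0, 1, 7} : Set ℤ) := by
    simp only [octant, Set.mem_insert_iff, Set.mem_singleton_iff]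
    rcases h with h | h | h | h <;> split_ifs <;> omega
  simp only [Set.mem_insert_iff, Set.mem_singleton_iff] at key
  unfold octantDiff
  split_ifs <;> omega

theorem IsUnitStep.neg {u : ℤ × ℤ} (h : IsUnitStep u) : IsUnitStep (-u) := by
  rcases h with rfl | rfl | rfl | rfl <;> simp [IsUnitStep]

theorem octantDiff_turn {u v : ℤ × ℤ} (hu : IsUnitStep u) (hv : IsUnitStep v)
    (h : u + v ≠ 0) : octantDiff u (u + v) + octantDiff (u + v) v = 2 * crossTurn u v := by
  rcases hu with rfl | rfl | rfl | rfl <;> rcases hv with rfl | rfl | rfl | rfl <;>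
    simp_all [octantDiff, octant, crossTurn]

/-! ### Hopf's secants and their lifted octants -/

/-- The octant of the secant from vertex `i` to vertex `i + 1 + m`, lifted to `ℤ`. -/
def secantLift (v : ℕ → ℤ × ℤ) (i m : ℕ) : ℤ :=
  2 * turning v i +
    ∑ k ∈ Finset.range m, octantDiff (v (i + 1 + k) - v i) (v (i + 1 + (k + 1)) - v i)

theorem secantLift_succ (v : ℕ → ℤ × ℤ) (i m : ℕ) : secantLift v i (m + 1) =
    secantLift v i m + octantDiff (v (i + 1 + m) - v i) (v (i + 1 + (m + 1)) - v i) := by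
  simp only [secantLift, Finset.sum_range_succ]; ring

/-- Path independence of the lift: the secant may change by moving its end or its start. This is
what lets the tangent angle be computed along another path of secants. -/
theorem secantLift_move {v : ℕ → ℤ × ℤ} {M : ℕ} (hu : ∀ i, IsUnitStep (stepVec v i))
    (hne : ∀ i j, i < j → j < i + M → v j - v i ≠ 0) (i m : ℕ) (hm : m + 2 < M) :
    secantLift v (i + 1) m = secantLift v i (m + 1) +
      octantDiff (v (i + 1 + (m + 1)) - v i) (v (i + 1 + (m + 1)) - v (i + 1)) := by
  induction m with
  | zero =>
    have h := octantDiff_turn (hu i) (hu (i + 1)) (by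
      have := hne i (i + 2) (by omega) (by omega)
      simpa [stepVec] using this)
    have e : stepVec v i + stepVec v (i + 1) = v (i + 2) - v i := by simp [stepVec]
    rw [e] at h
    simp only [secantLift, turning, Finset.sum_range_succ, Finset.sum_range_zero] at h ⊢
    simp only [stepVec, add_zero, zero_add] at h ⊢
    have e2 : i + 1 + 1 = i + 2 := rfl
    rw [e2] at h ⊢
    linarith
  | succ m ih =>
    have ih := ih (by omega)
    rw [secantLift_succ, ih, secantLift_succ v i (m + 1)]
    have e : i + 1 + 1 + m = i + 1 + (m + 1) := by omega
    have e' : i + 1 + 1 + (m + 1) = i + 1 + (m + 1 + 1) := by omega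
    rw [e, e']
    have n1 := hne i (i + 1 + (m + 1)) (by omega) (by omega)
    have n2 := hne i (i + 1 + (m + 1 + 1)) (by omega) (by omega)
    have n3 := hne (i + 1) (i + 1 + (m + 1)) (by omega) (by omega)
    have n4 := hne (i + 1) (i + 1 + (m + 1 + 1)) (by omega) (by omega)
    have u1 : IsUnitStep (v (i + 1 + (m + 1 + 1)) - v (i + 1 + (m + 1))) := hu (i + 1 + (m + 1))
    have u2 : IsUnitStep (-(v (i + 1) - v i)) := (hu i).neg
    have b1 := octantDiff_bound n1 n2 (by convert u1 using 1; abel)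
    have b2 := octantDiff_bound n3 n4 (by convert u1 using 1; abel)
    have b3 := octantDiff_bound n1 n3 (by convert u2 using 1; abel)
    have b4 := octantDiff_bound n2 n4 (by convert u2 using 1; abel)
    obtain ⟨k1, h1⟩ := octantDiff_eq_add_mul (v (i + 1 + (m + 1)) - v i)
      (v (i + 1 + (m + 1 + 1)) - v i)
    obtain ⟨k2, h2⟩ := octantDiff_eq_add_mul (v (i + 1 + (m + 1)) - v (i + 1))
      (v (i + 1 + (m + 1 + 1)) - v (i + 1))
    obtain ⟨k3, h3⟩ := octantDiff_eq_add_mul (v (i + 1 + (m + 1)) - v i)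
      (v (i + 1 + (m + 1)) - v (i + 1))
    obtain ⟨k4, h4⟩ := octantDiff_eq_add_mul (v (i + 1 + (m + 1 + 1)) - v i)
      (v (i + 1 + (m + 1 + 1)) - v (i + 1))
    -- The four differences around the square sum, with signs, to a multiple of `8`, and each is at
    -- most `1` in absolute value; so the sum is `0`.
    omega

/-- The upper half-plane, with the positive half of its boundary. -/
def IsUpper (p : ℤ × ℤ) : Prop := 0 < p.2 ∨ p.2 = 0 ∧ 0 < p.1

theorem IsUpper.octant_mem {p : ℤ × ℤ} (hp : IsUpper p) : 0 ≤ octant p ∧ octant p ≤ 3 := by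
  unfold IsUpper at hp
  unfold octant
  split_ifs <;> omega

theorem IsUpper.octant_neg_mem {p : ℤ × ℤ} (hp : IsUpper p) :
    4 ≤ octant (-p) ∧ octant (-p) ≤ 7 := by
  unfold IsUpper at hp
  simp only [octant, Prod.fst_neg, Prod.snd_neg]
  split_ifs <;> omega

theorem IsUpper.octantDiff {p q : ℤ × ℤ} (hp : IsUpper p) (hq : IsUpper q) :
    octantDiff p q = octant q - octant p := by
  have := hp.octant_mem
  have := hq.octant_mem
  unfold _root_.octantDiff
  split_ifs <;> omega

theorem IsUpper.octantDiff_neg {p q : ℤ × ℤ} (hp : IsUpper p) (hq : IsUpper q) :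
    _root_.octantDiff (-p) (-q) = octant (-q) - octant (-p) := by
  have := hp.octant_neg_mem
  have := hq.octant_neg_mem
  unfold _root_.octantDiff
  split_ifs <;> omega

/-- Here `p` is the first step from the lowest vertex and `q` the reversed last step to it. They
must be east and north in some order; the sign is the orientation. -/
theorem octant_sum_at_lowest {p q : ℤ × ℤ} (hp : IsUnitStep p) (hq : IsUnitStep q)
    (hp' : IsUpper p) (hq' : IsUpper q) (h : q - p ≠ 0) :
    octant q - octant p + octantDiff q (q - p) + octantDiff (q - p) (-p) + octant (-q)
      - octant (-p) + 2 * crossTurn (-q) p = 8 ∨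
    octant q - octant p + octantDiff q (q - p) + octantDiff (q - p) (-p) + octant (-q)
      - octant (-p) + 2 * crossTurn (-q) p = -8 := by
  rcases hp with rfl | rfl | rfl | rfl <;> rcases hq with rfl | rfl | rfl | rfl <;>
    first
    | (exfalso; revert hp' hq' h; simp [IsUpper]; done)
    | (left; rfl)
    | (right; rfl)

/-! ### Turning number of a simple lattice polygon -/

/-- A simple closed lattice polygon with `M` vertices, as a periodic sequence. -/
structure IsLatticePolygon (v : ℕ → ℤ × ℤ) (M : ℕ) : Prop where
  three_le : 3 ≤ M
  periodic : ∀ i, v (i + M) = v i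
  unit : ∀ i, IsUnitStep (stepVec v i)
  inj : ∀ i j, v i = v j → i ≡ j [MOD M]

theorem IsLatticePolygon.turning_of_lowest {v : ℕ → ℤ × ℤ} {M : ℕ} (h : IsLatticePolygon v M)
    (hlow : ∀ j, 0 < j → j < M → IsUpper (v j - v 0)) :
    turning v M = 4 ∨ turning v M = -4 := by
  have h3 := h.three_le
  have hne : ∀ i j, i < j → j < i + M → v j - v i ≠ 0 := by
    intro i j hij hj e
    have := (h.inj i j (sub_eq_zero.mp e).symm)
    rw [Nat.modEq_iff_dvd' hij.le] at this
    have := Nat.le_of_dvd (by omega) this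
    omega
  obtain ⟨K, rfl⟩ : ∃ K, M = K + 3 := ⟨M - 3, by omega⟩
  have hM : v (K + 3) = v 0 := by simpa using h.periodic 0
  have hM1 : v (K + 4) = v 1 := by
    have := h.periodic 1
    rwa [show 1 + (K + 3) = K + 4 by omega] at this
  -- Secants from the lowest vertex stay in a half-plane, where octants do not wrap around.
  have row : ∀ m, m < K + 2 → secantLift v 0 m = octant (v (m + 1) - v 0) - octant (v 1 - v 0) := by
    intro m hm
    induction m with
    | zero => simp [secantLift, turning]
    | succ m ih =>
      rw [secantLift_succ, ih (by omega), IsUpper.octantDiff]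
      · rw [show 0 + 1 + (m + 1) = m + 1 + 1 by omega, show 0 + 1 + m = m + 1 by omega]; ring
      · exact hlow _ (by omega) (by omega)
      · exact hlow _ (by omega) (by omega)
  -- Secants ending at the lowest vertex stay in the opposite half-plane.
  have col : ∀ i, i ≤ K + 1 → secantLift v (i + 1) (K + 1 - i) = secantLift v 1 (K + 1) +
      octant (-(v (i + 1) - v 0)) - octant (-(v 1 - v 0)) := by
    intro i hi
    induction i with
    | zero => simp
    | succ i ih =>
      have ih := ih (by omega)
      have mv := secantLift_move h.unit hne (i + 1) (K + 1 - (i + 1)) (by omega)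
      rw [show K + 1 - (i + 1) + 1 = K + 1 - i by omega,
        show i + 1 + 1 + (K + 1 - i) = K + 3 by omega, hM, ih] at mv
      have o := (hlow (i + 1) (by omega) (by omega)).octantDiff_neg
        (hlow (i + 1 + 1) (by omega) (by omega))
      rw [neg_sub, neg_sub] at o
      rw [mv, o, neg_sub, neg_sub]
      ring_nf
  have c := col (K + 1) le_rfl
  have r := row (K + 1) (by omega)
  -- The row and the column are joined through the secant from `v 1` to `v (K + 2)`, which avoids
  -- the degenerate secant from `v 0` to `v (K + 3) = v 0`.
  have mv := secantLift_move h.unit hne 0 K (by omega)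
  have sc := secantLift_succ v 1 K
  rw [show K + 1 - (K + 1) = 0 by omega] at c
  have t0 : secantLift v (K + 1 + 1) 0 = 2 * turning v (K + 2) := by simp [secantLift]
  have tM : turning v (K + 3) = turning v (K + 2) +
      crossTurn (stepVec v (K + 2)) (stepVec v (K + 3)) := by
    simp [turning, Finset.sum_range_succ]
  have s1 : stepVec v (K + 2) = v 0 - v (K + 2) := by simp [stepVec, hM]
  have s2 : stepVec v (K + 3) = v 1 - v 0 := by simp [stepVec, hM, hM1]
  rw [show 0 + 1 + (K + 1) = K + 2 by omega, zero_add] at mv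
  rw [show 1 + 1 + K = K + 2 by omega, show 1 + 1 + (K + 1) = K + 3 by omega, hM] at sc
  rw [show K + 1 + 1 = K + 2 by omega] at c r t0
  have hu0 : IsUnitStep (v 1 - v 0) := h.unit 0
  have hu1 : IsUnitStep (-(v 0 - v (K + 2))) := s1 ▸ (h.unit (K + 2)).neg
  have l0 := hlow 1 (by omega) (by omega)
  have l1 := hlow (K + 2) (by omega) (by omega)
  have hd : v (K + 2) - v 1 ≠ 0 := hne 1 (K + 2) (by omega) (by omega)
  rw [tM, s1, s2]
  rw [neg_sub] at hu1
  have e1 : v (K + 2) - v 1 = (v (K + 2) - v 0) - (v 1 - v 0) := by abel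
  have e2 : v 0 - v 1 = -(v 1 - v 0) := by abel
  have e3 : v 0 - v (K + 2) = -(v (K + 2) - v 0) := by abel
  rw [e1] at hd mv sc
  rw [e2] at sc
  rw [e3]
  have key := octant_sum_at_lowest hu0 hu1 l0 l1 hd
  omega

theorem turning_shift_of_periodic {v : ℕ → ℤ × ℤ} {M : ℕ} (h : ∀ i, v (i + M) = v i) (k : ℕ) :
    turning (fun i => v (i + k)) M = turning v M := by
  induction k with
  | zero => rfl
  | succ k ih =>
    rw [← ih]
    have a := Finset.sum_range_succ (fun i => crossTurn (stepVec (fun i => v (i + k)) i)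
      (stepVec (fun i => v (i + k)) (i + 1))) M
    rw [Finset.sum_range_succ'] at a
    have hs : ∀ i, v (M + i) = v i := fun i => by rw [add_comm]; exact h i
    simp only [stepVec, add_assoc] at a
    simp only [hs, turning, stepVec, zero_add, add_assoc] at a ⊢
    simp only [add_comm 1 k, add_comm 1 (k+1)] at *
    have := add_right_cancel a
    rw [← this]

/-- The turning number of a simple closed lattice polygon is `±4` quarter turns. -/
theorem IsLatticePolygon.turning_eq {v : ℕ → ℤ × ℤ} {M : ℕ} (h : IsLatticePolygon v M) :
    turning v M = 4 ∨ turning v M = -4 := by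
  have h3 := h.three_le
  -- The leftmost of the lowest vertices: all others lie in the half-plane `IsUpper` seen from it.
  obtain ⟨k, hk, hmin⟩ := Finset.exists_min_image (Finset.range M)
    (fun i => toLex ((v i).2, (v i).1)) ⟨0, by simp; omega⟩
  rw [← turning_shift_of_periodic h.periodic k]
  have hmod : ∀ i, v (i % M) = v i := by
    have : ∀ i q, v (i + M * q) = v i := by
      intro i q
      induction q with
      | zero => simp
      | succ q ih => rw [Nat.mul_succ, ← add_assoc, h.periodic, ih]
    intro i
    conv_rhs => rw [← Nat.mod_add_div i M, this]
  have hp : IsLatticePolygon (fun i => v (i + k)) M :=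
    { three_le := h3
      periodic := fun i => by
        rw [add_right_comm]; exact h.periodic _
      unit := fun i => by
        have := h.unit (i + k)
        simpa [stepVec, add_right_comm] using this
      inj := fun i j e => Nat.ModEq.add_right_cancel' k (h.inj _ _ e) }
  refine hp.turning_of_lowest fun j hj hjM => ?_
  have hle := hmin ((j + k) % M) (by simp; exact Nat.mod_lt _ (by omega))
  rw [hmod, Prod.Lex.toLex_le_toLex] at hle
  have hne : v (j + k) ≠ v k := by
    intro e
    have e := h.inj (j + k) (0 + k) (by simpa using e)
    have := Nat.ModEq.add_right_cancel' k e
    rw [Nat.ModEq, Nat.mod_eq_of_lt hjM, Nat.zero_mod] at this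
    omega
  simp only [IsUpper, zero_add, Prod.fst_sub, Prod.snd_sub] at hle ⊢
  by_contra hcon
  exact hne (Prod.ext (by omega) (by omega))

/-! ### Self-avoiding walks closed by an eastward segment -/

/-- The first `N` steps of `w` form a self-avoiding walk on the lattice `ℤ × ℤ`. -/
structure IsLatticePath (w : ℕ → ℤ × ℤ) (N : ℕ) : Prop where
  unit : ∀ i < N, IsUnitStep (stepVec w i)
  inj : ∀ i ≤ N, ∀ j ≤ N, w i = w j → i = j

theorem IsLatticePath.take {w : ℕ → ℤ × ℤ} {N k : ℕ} (h : IsLatticePath w N) (hk : k ≤ N) :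
    IsLatticePath w k where
  unit i hi := h.unit i (by omega)
  inj i hi j hj := h.inj i (by omega) j (by omega)

theorem IsLatticePath.drop {w : ℕ → ℤ × ℤ} {k N : ℕ} (h : IsLatticePath w (k + N)) :
    IsLatticePath (fun i => w (k + i)) N where
  unit i hi := h.unit (k + i) (by omega)
  inj i hi j hj e := by
    have := h.inj (k + i) (by omega) (k + j) (by omega) e
    omega

theorem turning_add (w : ℕ → ℤ × ℤ) (k m : ℕ) : turning w (k + 1 + m) =
    turning w k + crossTurn (stepVec w k) (stepVec w (k + 1)) +
      turning (fun i => w (k + 1 + i)) m := by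
  simp only [turning, Finset.sum_range_add, Finset.sum_range_succ]
  rfl

theorem IsLatticePath.step_add_ne_zero {w : ℕ → ℤ × ℤ} {N k : ℕ} (h : IsLatticePath w N)
    (hk : k + 2 ≤ N) : stepVec w k + stepVec w (k + 1) ≠ 0 := by
  intro e
  have e : w (k + 1 + 1) - w k = 0 := by rw [← e]; simp [stepVec]
  have := h.inj _ (by omega) _ (by omega) (sub_eq_zero.mp e)
  omega

/-- The walk `w` of length `m + 1` followed by a walk to the east of length `c` that leads back to
`w 0`, repeated periodically. -/
def eastClosure (w : ℕ → ℤ × ℤ) (m c : ℕ) (i : ℕ) : ℤ × ℤ :=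
  if i % (m + 1 + c) ≤ m + 1 then w (i % (m + 1 + c))
  else w 0 + (((i % (m + 1 + c) : ℕ) : ℤ) - (m + 1 + c : ℕ), 0)

section

variable {w : ℕ → ℤ × ℤ} {m c : ℕ}

theorem eastClosure_of_le (hc : 1 ≤ c) {i : ℕ} (hi : i ≤ m + 1) :
    eastClosure w m c i = w i := by
  rw [eastClosure, Nat.mod_eq_of_lt (by omega), if_pos hi]

theorem eastClosure_of_ge (hend : w (m + 1) = w 0 - ((c : ℤ), 0)) {i : ℕ} (hi : m + 1 ≤ i)
    (hi' : i ≤ m + 1 + c) :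
    eastClosure w m c i = w 0 + ((i : ℤ) - (m + 1 + c : ℕ), 0) := by
  rcases hi'.lt_or_eq with h | h
  · rw [eastClosure, Nat.mod_eq_of_lt h]
    split_ifs with h1
    · obtain rfl : i = m + 1 := by omega
      rw [hend]
      ext <;> simp
      ring
    · rfl
  · subst h
    simp [eastClosure]

theorem eastClosure_mod (i : ℕ) :
    eastClosure w m c (i % (m + 1 + c)) = eastClosure w m c i := by
  simp [eastClosure]

theorem stepVec_eastClosure_mod (i : ℕ) :
    stepVec (eastClosure w m c) (i % (m + 1 + c)) = stepVec (eastClosure w m c) i := by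
  rw [stepVec, stepVec, eastClosure_mod i, ← eastClosure_mod (i % (m + 1 + c) + 1),
    ← eastClosure_mod (i + 1)]
  simp

theorem stepVec_eastClosure_of_le (hc : 1 ≤ c) {i : ℕ} (hi : i ≤ m) :
    stepVec (eastClosure w m c) i = stepVec w i := by
  rw [stepVec, stepVec, eastClosure_of_le hc (by omega), eastClosure_of_le hc (by omega)]

theorem stepVec_eastClosure_of_ge (hend : w (m + 1) = w 0 - ((c : ℤ), 0)) {i : ℕ}
    (hi : m + 1 ≤ i) (hi' : i < m + 1 + c) :
    stepVec (eastClosure w m c) i = (1, 0) := by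
  rw [stepVec, eastClosure_of_ge hend (by omega) (by omega),
    eastClosure_of_ge hend (by omega) (by omega)]
  ext <;> simp

theorem IsLatticePath.isLatticePolygon_eastClosure (h : IsLatticePath w (m + 1)) (hc : 1 ≤ c)
    (hend : w (m + 1) = w 0 - ((c : ℤ), 0))
    (havoid : ∀ i, 1 ≤ i → i ≤ m + 1 → ∀ b : ℕ, 0 < b → b < c → w i ≠ w 0 - ((b : ℤ), 0))
    (hm : 3 ≤ m + 1 + c) : IsLatticePolygon (eastClosure w m c) (m + 1 + c) := by
  have mixed : ∀ i j, i ≤ m + 1 → m + 1 < j → j < m + 1 + c →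
      eastClosure w m c i ≠ eastClosure w m c j := by
    intro i j hi hj hj' e
    rw [eastClosure_of_le hc hi, eastClosure_of_ge hend hj.le hj'.le] at e
    have e : w i = w 0 - (((m + 1 + c - j : ℕ) : ℤ), 0) := by
      rw [e, Nat.cast_sub hj'.le]
      ext <;> simp
      ring
    rcases Nat.eq_zero_or_pos i with rfl | hi0
    · have := congrArg Prod.fst e
      simp only [Prod.fst_sub] at this
      omega
    · exact havoid i hi0 hi _ (by omega) (by omega) e
  refine ⟨hm, fun i => by simp [eastClosure], fun i => ?_, fun i j e => ?_⟩
  · rw [← stepVec_eastClosure_mod]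
    have hlt : i % (m + 1 + c) < m + 1 + c := Nat.mod_lt _ (by omega)
    rcases Nat.lt_or_ge m (i % (m + 1 + c)) with h1 | h1
    · rw [stepVec_eastClosure_of_ge hend h1 hlt]
      exact Or.inl rfl
    · rw [stepVec_eastClosure_of_le hc h1]
      exact h.unit _ (by omega)
  · rw [← eastClosure_mod i, ← eastClosure_mod j] at e
    have hi : i % (m + 1 + c) < m + 1 + c := Nat.mod_lt _ (by omega)
    have hj : j % (m + 1 + c) < m + 1 + c := Nat.mod_lt _ (by omega)
    rw [Nat.ModEq]
    generalize i % (m + 1 + c) = r at *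
    generalize j % (m + 1 + c) = s at *
    rcases Nat.lt_or_ge (m + 1) r with h1 | h1 <;> rcases Nat.lt_or_ge (m + 1) s with h2 | h2
    · rw [eastClosure_of_ge hend h1.le hi.le, eastClosure_of_ge hend h2.le hj.le] at e
      have := congrArg Prod.fst e
      simp only [Prod.fst_add] at this
      omega
    · exact absurd e.symm (mixed s r h2 h1 hi)
    · exact absurd e (mixed r s h1 h2 hj)
    · rw [eastClosure_of_le hc h1, eastClosure_of_le hc h2] at e
      exact h.inj r h1 s h2 e

/-- The turning of a self-avoiding walk that ends west of its starting point, on the same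
horizontal line, and does not visit the points between them. -/
theorem IsLatticePath.turning_of_avoids (h : IsLatticePath w (m + 1)) (hc : 1 ≤ c)
    (hend : w (m + 1) = w 0 - ((c : ℤ), 0))
    (havoid : ∀ i, 1 ≤ i → i ≤ m + 1 → ∀ b : ℕ, 0 < b → b < c → w i ≠ w 0 - ((b : ℤ), 0))
    (hm : 3 ≤ m + 1 + c) :
    turning w m = 4 + (stepVec w m).2 - (stepVec w 0).2 ∨
    turning w m = -4 + (stepVec w m).2 - (stepVec w 0).2 := by
  have key := (h.isLatticePolygon_eastClosure hc hend havoid hm).turning_eq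
  -- The closing segment is straight and adds only the corners at its two ends, whose cross products
  -- with `(1, 0)` are these second coordinates.
  suffices hs : turning (eastClosure w m c) (m + 1 + c) =
      turning w m - (stepVec w m).2 + (stepVec w 0).2 by omega
  obtain ⟨d, rfl⟩ : ∃ d, c = d + 1 := ⟨c - 1, by omega⟩
  rw [turning, ← add_assoc (m + 1) d 1, Finset.sum_range_succ, Finset.sum_range_add,
    Finset.sum_range_succ, turning]
  have e1 : ∑ i ∈ Finset.range m, crossTurn (stepVec (eastClosure w m (d + 1)) i)
      (stepVec (eastClosure w m (d + 1)) (i + 1)) =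
      ∑ i ∈ Finset.range m, crossTurn (stepVec w i) (stepVec w (i + 1)) := by
    refine Finset.sum_congr rfl fun i hi => ?_
    rw [Finset.mem_range] at hi
    rw [stepVec_eastClosure_of_le hc hi.le, stepVec_eastClosure_of_le hc hi]
  have e2 : ∑ i ∈ Finset.range d, crossTurn (stepVec (eastClosure w m (d + 1)) (m + 1 + i))
      (stepVec (eastClosure w m (d + 1)) (m + 1 + i + 1)) = 0 := by
    refine Finset.sum_eq_zero fun i hi => ?_
    rw [Finset.mem_range] at hi
    rw [stepVec_eastClosure_of_ge hend (by omega) (by omega),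
      stepVec_eastClosure_of_ge hend (by omega) (by omega)]
    rfl
  have e3 : stepVec (eastClosure w m (d + 1)) (m + 1 + d + 1) = stepVec w 0 := by
    rw [← stepVec_eastClosure_mod, show m + 1 + d + 1 = m + 1 + (d + 1) by omega, Nat.mod_self,
      stepVec_eastClosure_of_le hc (Nat.zero_le _)]
  rw [e1, e2, e3, stepVec_eastClosure_of_le hc le_rfl,
    stepVec_eastClosure_of_ge hend le_rfl (by omega),
    stepVec_eastClosure_of_ge hend (by omega) (by omega)]
  simp only [crossTurn]
  ring

end

/-! ### The turning bound at distance `a` -/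

/-- The direction of a unit step in quarter turns from the east, with `2` for the west. -/
def startAngle (u : ℤ × ℤ) : ℤ := u.2 + (u.1 ^ 2 - u.1)

/-- The direction of a unit step in quarter turns from the east, with `-2` for the west. -/
def endAngle (u : ℤ × ℤ) : ℤ := u.2 - (u.1 ^ 2 - u.1)

theorem IsUnitStep.startAngle_eq {u : ℤ × ℤ} (h : IsUnitStep u) (hW : u ≠ (-1, 0)) :
    startAngle u = u.2 := by
  rcases h with rfl | rfl | rfl | rfl <;> simp_all [startAngle]

theorem IsUnitStep.endAngle_eq {u : ℤ × ℤ} (h : IsUnitStep u) (hW : u ≠ (-1, 0)) :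
    endAngle u = u.2 := by
  rcases h with rfl | rfl | rfl | rfl <;> simp_all [endAngle]

/-- Lets the corner between two consecutive pieces cancel their end corrections in the induction of
`IsLatticePath.turning_le`. -/
theorem crossTurn_le_startAngle_sub {u v : ℤ × ℤ} (hu : IsUnitStep u) (hv : IsUnitStep v)
    (hW : u ≠ (-1, 0)) (h : u + v ≠ 0) : crossTurn u v ≤ startAngle v - u.2 := by
  rcases hu with rfl | rfl | rfl | rfl <;> rcases hv with rfl | rfl | rfl | rfl <;>
    simp_all [startAngle, crossTurn]

theorem crossTurn_west_le {v : ℤ × ℤ} (hv : IsUnitStep v) :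
    crossTurn (-1, 0) v ≤ startAngle v + 2 := by
  rcases hv with rfl | rfl | rfl | rfl <;> simp [startAngle, crossTurn]

/-- A self-avoiding walk that ends at distance `a` to the west of its starting point has turning at
most `4 * a`, up to a correction for its first and last direction. -/
theorem IsLatticePath.turning_le (a : ℕ) : ∀ {w : ℕ → ℤ × ℤ} {m : ℕ},
    IsLatticePath w (m + 1) → 1 ≤ a → w (m + 1) = w 0 - ((a : ℤ), 0) →
    turning w m ≤ 4 * a + endAngle (stepVec w m) - startAngle (stepVec w 0) := by
  induction a using Nat.strong_induction_on with
  | _ a IH =>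
  intro w m h ha hend
  classical
  -- The least such `c` is the distance to the nearest point of the westward ray visited after time
  -- `0`.
  have hex : ∃ c : ℕ, 1 ≤ c ∧ ∃ k, k ≤ m ∧ w (k + 1) = w 0 - ((c : ℤ), 0) :=
    ⟨a, ha, m, le_rfl, hend⟩
  obtain ⟨hc, k, hk, hkc⟩ := Nat.find_spec hex
  have hmin := fun b (hb : b < Nat.find hex) => Nat.find_min hex hb
  have hca := Nat.find_min' hex ⟨ha, m, le_rfl, hend⟩
  generalize Nat.find hex = c at *
  have havoid : ∀ i, 1 ≤ i → i ≤ m + 1 → ∀ b : ℕ, 0 < b → b < c → w i ≠ w 0 - ((b : ℤ), 0) :=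
    fun i hi hi' b hb hbc e =>
      hmin b hbc ⟨hb, i - 1, by omega, by rwa [Nat.sub_add_cancel hi]⟩
  have u0 : IsUnitStep (stepVec w 0) := h.unit 0 (by omega)
  have uk : IsUnitStep (stepVec w k) := h.unit k (by omega)
  -- The part of the walk up to the point nearest to `w 0` on the segment to its end point.
  have first : (k = 0 ∧ c = 1 ∧ stepVec w 0 = (-1, 0)) ∨
      (stepVec w k ≠ (-1, 0) ∧ stepVec w 0 ≠ (-1, 0) ∧
        turning w k ≤ 4 + (stepVec w k).2 - (stepVec w 0).2) := by
    rcases Nat.eq_zero_or_pos k with rfl | hk0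
    · left
      have e : stepVec w 0 = (-(c : ℤ), 0) := by
        rw [stepVec, hkc]
        ext <;> simp
      rw [e] at u0 ⊢
      simp only [IsUnitStep, Prod.mk.injEq, and_true, true_and] at u0 ⊢
      omega
    · right
      -- Arriving by a west step would mean coming from a nearer point of the ray, or from `w 0`
      -- itself.
      have hW : stepVec w k ≠ (-1, 0) := by
        intro e
        have e : w k = w 0 - (((c - 1 : ℕ) : ℤ), 0) := by
          have : w k = w (k + 1) - stepVec w k := by simp [stepVec]
          rw [this, e, hkc, Nat.cast_sub hc]
          ext <;> simp
          ring
        rcases Nat.lt_or_ge 1 c with h1 | h1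
        · exact havoid k hk0 (by omega) (c - 1) (by omega) (by omega) e
        · have e : w k = w 0 := by
            rw [e, show c - 1 = 0 by omega]
            ext <;> simp
          have := h.inj k (by omega) 0 (by omega) e
          omega
      have hW0 : stepVec w 0 ≠ (-1, 0) := by
        intro e
        have e : w 1 = w 0 - (((1 : ℕ) : ℤ), 0) := by
          have : w 1 = w 0 + stepVec w 0 := by simp [stepVec]
          rw [this, e]
          ext <;> simp
          ring
        rcases Nat.lt_or_ge 1 c with h1 | h1
        · exact havoid 1 le_rfl (by omega) 1 (by omega) h1 e
        · obtain rfl : c = 1 := by omega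
          have := h.inj (k + 1) (by omega) 1 (by omega) (hkc.trans e.symm)
          omega
      have := (h.take (k := k + 1) (by omega)).turning_of_avoids hc hkc
        (fun i hi hi' => havoid i hi (by omega)) (by omega)
      exact ⟨hW, hW0, by omega⟩
  rcases Nat.eq_or_lt_of_le hk with rfl | hkm
  · obtain rfl : c = a := by
      have := congrArg Prod.fst (hkc.symm.trans hend)
      simp only [Prod.fst_sub] at this
      omega
    rcases first with ⟨rfl, rfl, e⟩ | ⟨hW, hW0, ht⟩
    · rw [e]
      simp [turning, endAngle, startAngle]
    · rw [uk.endAngle_eq hW, u0.startAngle_eq hW0]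
      have : (1 : ℤ) ≤ c := by exact_mod_cast hc
      omega
  · obtain ⟨n, rfl⟩ : ∃ n, m = k + 1 + n := ⟨m - (k + 1), by omega⟩
    have hca' : c < a := by
      rcases hca.lt_or_eq with h1 | rfl
      · exact h1
      · have := h.inj (k + 1) (by omega) (k + 1 + n + 1) le_rfl (hkc.trans hend.symm)
        omega
    -- The rest of the walk starts at distance `c` and ends `a - c` further west.
    have hrest := IH (a - c) (by omega) (w := fun i => w (k + 1 + i))
      (IsLatticePath.drop (by rwa [add_assoc] at h)) (by omega) (by
        show w (k + 1 + n + 1) = w (k + 1) - _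
        rw [hend, hkc, Nat.cast_sub hca]
        ext <;> simp)
    have s1 : stepVec (fun i => w (k + 1 + i)) n = stepVec w (k + 1 + n) := rfl
    have s2 : stepVec (fun i => w (k + 1 + i)) 0 = stepVec w (k + 1) := rfl
    rw [s1, s2, Nat.cast_sub hca] at hrest
    have uk1 : IsUnitStep (stepVec w (k + 1)) := h.unit _ (by omega)
    have hc' : (1 : ℤ) ≤ c := by exact_mod_cast hc
    rw [turning_add]
    rcases first with ⟨rfl, rfl, e⟩ | ⟨hW, hW0, ht⟩
    · rw [e] at *
      have := crossTurn_west_le uk1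
      have e0 : startAngle (-1, 0) = 2 := rfl
      have e1 : turning w 0 = 0 := rfl
      rw [e0, e1]
      push_cast at hrest
      linarith
    · have := crossTurn_le_startAngle_sub uk uk1 hW (h.step_add_ne_zero (by omega))
      rw [u0.startAngle_eq hW0]
      linarith

/-! ### Turn sequences and net turning -/

/-- The number of left turns minus the number of right turns. -/
def netTurn (σ : List Turn) : ℤ := (σ.count Turn.L : ℤ) - σ.count Turn.R

/-- The unit step that makes `k` quarter turns with the east. -/
def quarterDir (k : ℤ) : ℤ × ℤ :=
  if k % 4 = 0 then (1, 0) else if k % 4 = 1 then (0, 1) else if k % 4 = 2 then (-1, 0)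
  else (0, -1)

theorem isUnitStep_quarterDir (k : ℤ) : IsUnitStep (quarterDir k) := by
  unfold quarterDir IsUnitStep
  split_ifs <;> simp

theorem rotate_quarterDir_L (k : ℤ) : Turn.rotate (quarterDir k) Turn.L = quarterDir (k + 1) := by
  unfold quarterDir
  split_ifs <;> first | omega | simp [Turn.rotate]

theorem rotate_quarterDir_R (k : ℤ) : Turn.rotate (quarterDir k) Turn.R = quarterDir (k - 1) := by
  unfold quarterDir
  split_ifs <;> first | omega | simp [Turn.rotate]

theorem netTurn_append_L (σ : List Turn) : netTurn (σ ++ [Turn.L]) = netTurn σ + 1 := by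
  simp [netTurn]
  ring

theorem netTurn_append_R (σ : List Turn) : netTurn (σ ++ [Turn.R]) = netTurn σ - 1 := by
  simp [netTurn]
  ring

theorem foldl_rotate (σ : List Turn) :
    σ.foldl Turn.rotate (1, 0) = quarterDir (netTurn σ) := by
  induction σ using List.reverseRecOn with
  | nil => rfl
  | append_singleton σ t ih =>
    rw [List.foldl_append, List.foldl_cons, List.foldl_nil, ih]
    cases t
    · rw [rotate_quarterDir_L, netTurn_append_L]
    · rw [rotate_quarterDir_R, netTurn_append_R]

theorem segmentDir_eq (σ : List Turn) (i : ℕ) :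
    segmentDir σ i = quarterDir (netTurn (σ.take i)) :=
  foldl_rotate _

theorem isUnitStep_segmentDir (σ : List Turn) (i : ℕ) : IsUnitStep (segmentDir σ i) := by
  rw [segmentDir_eq]
  exact isUnitStep_quarterDir _

theorem crossTurn_rotate {u : ℤ × ℤ} (hu : IsUnitStep u) :
    crossTurn u (Turn.rotate u Turn.L) = 1 ∧ crossTurn u (Turn.rotate u Turn.R) = -1 := by
  rcases hu with rfl | rfl | rfl | rfl <;> simp [crossTurn, Turn.rotate]

theorem netTurn_take_succ (σ : List Turn) {i : ℕ} (hi : i < σ.length) :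
    netTurn (σ.take (i + 1)) =
      netTurn (σ.take i) + crossTurn (segmentDir σ i) (segmentDir σ (i + 1)) := by
  have e : σ.take (i + 1) = σ.take i ++ [σ[i]] := by simp
  have hd : segmentDir σ (i + 1) = Turn.rotate (segmentDir σ i) σ[i] := by
    rw [segmentDir, e, List.foldl_append]
    rfl
  have h := crossTurn_rotate (isUnitStep_segmentDir σ i)
  rw [hd, e]
  cases σ[i]
  · rw [netTurn_append_L, h.1]
  · rw [netTurn_append_R, h.2]
    ring

/-! ### Refining a chain to a lattice walk -/

/-- The walk `w`, continued after `N` steps in the direction `u`. -/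
def extendWalk (w : ℕ → ℤ × ℤ) (N : ℕ) (u : ℤ × ℤ) (i : ℕ) : ℤ × ℤ :=
  if i ≤ N then w i else w N + (i - N) • u

section

variable {w : ℕ → ℤ × ℤ} {N : ℕ} {u : ℤ × ℤ}

theorem extendWalk_of_le {i : ℕ} (hi : i ≤ N) : extendWalk w N u i = w i := if_pos hi

theorem extendWalk_add (j : ℕ) : extendWalk w N u (N + j) = w N + j • u := by
  rcases Nat.eq_zero_or_pos j with rfl | hj
  · simp [extendWalk]
  · simp [extendWalk, hj.ne']

theorem stepVec_extendWalk_of_lt {i : ℕ} (hi : i < N) :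
    stepVec (extendWalk w N u) i = stepVec w i := by
  rw [stepVec, stepVec, extendWalk_of_le hi, extendWalk_of_le hi.le]

theorem stepVec_extendWalk_add (j : ℕ) : stepVec (extendWalk w N u) (N + j) = u := by
  rw [stepVec, add_assoc, extendWalk_add, extendWalk_add, add_smul]
  simp

theorem turning_extendWalk (w : ℕ → ℤ × ℤ) (m : ℕ) (u : ℤ × ℤ) (d : ℕ) :
    turning (extendWalk w (m + 1) u) (m + 1 + d) = turning w m + crossTurn (stepVec w m) u := by
  have h0 : stepVec (extendWalk w (m + 1) u) (m + 1) = u := stepVec_extendWalk_add 0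
  have h1 : turning (extendWalk w (m + 1) u) m = turning w m := by
    refine Finset.sum_congr rfl fun i hi => ?_
    rw [Finset.mem_range] at hi
    rw [stepVec_extendWalk_of_lt (by omega), stepVec_extendWalk_of_lt (by omega)]
  have h2 : turning (fun i => extendWalk w (m + 1) u (m + 1 + i)) d = 0 := by
    refine Finset.sum_eq_zero fun i _ => ?_
    have e : ∀ j, stepVec (fun i => extendWalk w (m + 1) u (m + 1 + i)) j = u :=
      fun j => stepVec_extendWalk_add j
    rw [e, e, crossTurn]
    ring
  rw [turning_add, h0, h1, h2, stepVec_extendWalk_of_lt (by omega), add_zero]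

theorem IsUnitStep.nsmul_left_injective (hu : IsUnitStep u) {i j : ℕ} (h : i • u = j • u) :
    i = j := by
  rcases hu with rfl | rfl | rfl | rfl <;> simpa using h

theorem IsLatticePath.extendWalk (h : IsLatticePath w N) (hu : IsUnitStep u) {d : ℕ}
    (hdisj : ∀ i ≤ N, ∀ j, 1 ≤ j → j ≤ d → w i ≠ w N + j • u) :
    IsLatticePath (extendWalk w N u) (N + d) where
  unit i hi := by
    rcases Nat.lt_or_ge i N with h1 | h1
    · rw [stepVec_extendWalk_of_lt h1]
      exact h.unit i h1
    · obtain ⟨j, rfl⟩ := Nat.exists_eq_add_of_le h1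
      rwa [stepVec_extendWalk_add]
  inj i hi j hj e := by
    rcases Nat.le_or_ge i N with h1 | h1 <;> rcases Nat.le_or_ge j N with h2 | h2
    · rw [extendWalk_of_le h1, extendWalk_of_le h2] at e
      exact h.inj i h1 j h2 e
    · obtain ⟨k, rfl⟩ := Nat.exists_eq_add_of_le h2
      rcases Nat.eq_zero_or_pos k with rfl | hk
      · rw [extendWalk_of_le h1, extendWalk_of_le (by omega)] at e
        exact h.inj i h1 N le_rfl e
      · rw [extendWalk_of_le h1, extendWalk_add] at e
        exact absurd e (hdisj i h1 k hk (by omega))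
    · obtain ⟨k, rfl⟩ := Nat.exists_eq_add_of_le h1
      rcases Nat.eq_zero_or_pos k with rfl | hk
      · rw [extendWalk_of_le h2, extendWalk_of_le (by omega)] at e
        exact h.inj N le_rfl j h2 e
      · rw [extendWalk_of_le h2, extendWalk_add] at e
        exact absurd e.symm (hdisj j h2 k hk (by omega))
    · obtain ⟨k, rfl⟩ := Nat.exists_eq_add_of_le h1
      obtain ⟨k', rfl⟩ := Nat.exists_eq_add_of_le h2
      rw [extendWalk_add, extendWalk_add] at e
      rw [hu.nsmul_left_injective (add_left_cancel e)]

end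

theorem toPlane_injective : Function.Injective toPlane := by
  rintro ⟨x, y⟩ ⟨x', y'⟩ h
  simpa [toPlane] using h

theorem toPlane_add_nsmul_mem_segment (p u : ℤ × ℤ) {j len : ℕ} (hj : j ≤ len) (hlen : 0 < len) :
    toPlane (p + j • u) ∈ segment ℝ (toPlane p) (toPlane (p + len • u)) := by
  have h0 : (len : ℝ) ≠ 0 := by positivity
  refine ⟨1 - j / len, j / len, ?_, by positivity, by ring, ?_⟩
  · rw [sub_nonneg, div_le_one (by positivity)]
    exact_mod_cast hj
  · ext <;> simp [toPlane] <;> field_simp <;> ring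

/-- The refinement of an initial part of a chain to a self-avoiding lattice walk. -/
theorem Realizes.exists_isLatticePath {σ : List Turn} {v : ℕ → ℤ × ℤ} (h : Realizes σ v) (k : ℕ)
    (hk : k ≤ σ.length) : ∃ w m, IsLatticePath w (m + 1) ∧ w 0 = (0, 0) ∧ w (m + 1) = v (k + 1) ∧
      stepVec w 0 = (1, 0) ∧ stepVec w m = segmentDir σ k ∧
      turning w m = netTurn (σ.take k) ∧
      ∀ i ≤ m + 1, ∃ s ≤ k, toPlane (w i) ∈ chainSegment v s := by
  induction k with
  | zero =>
    obtain ⟨len, hlen, e⟩ := h.step 0 hk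
    obtain ⟨m, rfl⟩ : ∃ m, len = m + 1 := ⟨len - 1, by omega⟩
    have hE : IsUnitStep (1, 0) := Or.inl rfl
    have hstep : ∀ i, stepVec (fun i : ℕ => i • ((1, 0) : ℤ × ℤ)) i = (1, 0) := fun i => by
      simp [stepVec]
    have hdir : segmentDir σ 0 = (1, 0) := rfl
    rw [h.start, hdir] at e
    refine ⟨fun i => i • (1, 0), m, ⟨fun i _ => ?_, fun i _ j _ hij => ?_⟩, by simp; rfl, ?_, hstep 0,
      ?_, ?_, fun i hi => ⟨0, le_rfl, ?_⟩⟩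
    · rw [hstep]
      exact hE
    · exact hE.nsmul_left_injective hij
    · rw [e]
      simp
    · rw [hstep, hdir]
    · simp only [turning, hstep]
      simp [netTurn, crossTurn]
    · have := toPlane_add_nsmul_mem_segment (0, 0) (1, 0) hi hlen
      rw [← e] at this
      rw [chainSegment, h.start]
      simpa using this
  | succ k ih =>
    obtain ⟨w, m, hw, hw0, hwm, hs0, hsm, ht, hcov⟩ := ih (by omega)
    obtain ⟨len, hlen, e⟩ := h.step (k + 1) hk
    obtain ⟨d, rfl⟩ : ∃ d, len = d + 1 := ⟨len - 1, by omega⟩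
    have hu := isUnitStep_segmentDir σ (k + 1)
    have hmem : ∀ j ≤ d + 1, toPlane (w (m + 1) + j • segmentDir σ (k + 1)) ∈
        chainSegment v (k + 1) := fun j hj => by
      rw [chainSegment, e, hwm]
      exact toPlane_add_nsmul_mem_segment _ _ hj hlen
    refine ⟨extendWalk w (m + 1) (segmentDir σ (k + 1)), m + 1 + d,
      hw.extendWalk hu (d := d + 1) ?_, ?_, ?_, ?_, stepVec_extendWalk_add d, ?_, ?_⟩
    -- A lattice point on both an earlier segment and the new one must be their common vertex `v (k
    -- + 1)`, which forces `j = 0`.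
    · intro i hi j hj hjd hij
      obtain ⟨s, hs, hmems⟩ := hcov i hi
      have hmemk := hmem j hjd
      rw [← hij] at hmemk
      obtain ⟨-, hq⟩ := h.simple s (k + 1) (by omega) hk _ ⟨hmems, hmemk⟩
      have hq := toPlane_injective hq
      rw [hij, hwm, add_eq_left] at hq
      have := hu.nsmul_left_injective (i := j) (j := 0) (by rw [hq, zero_smul])
      omega
    · rw [extendWalk_of_le (Nat.zero_le _), hw0]
    · rw [add_assoc (m + 1), extendWalk_add, hwm, e]
    · rw [stepVec_extendWalk_of_lt (by omega), hs0]
    · rw [turning_extendWalk, ht, hsm, ← netTurn_take_succ σ (by omega)]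
    · intro i hi
      rcases Nat.le_or_ge i (m + 1) with h1 | h1
      · obtain ⟨s, hs, hm⟩ := hcov i h1
        exact ⟨s, by omega, by rwa [extendWalk_of_le h1]⟩
      · obtain ⟨j, rfl⟩ := Nat.exists_eq_add_of_le h1
        exact ⟨k + 1, le_rfl, by rw [extendWalk_add]; exact hmem j (by omega)⟩

/-! ### Lower bounds for the distance -/

/-- Bounds for the turning of a self-avoiding walk that starts at the origin to the east and ends on
the negative `x`-axis. -/
theorem IsLatticePath.turning_bounds {w : ℕ → ℤ × ℤ} {m : ℕ} (h : IsLatticePath w (m + 1))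
    (h0 : w 0 = (0, 0)) (hE : stepVec w 0 = (1, 0)) {b : ℕ} (hb : 1 ≤ b)
    (hend : w (m + 1) = (-(b : ℤ), 0)) :
    turning w m ≤ 4 * b + endAngle (stepVec w m) ∧
    (b = 1 → turning w m = 4 + (stepVec w m).2 ∨ turning w m = -4 + (stepVec w m).2) := by
  have hend' : w (m + 1) = w 0 - ((b : ℤ), 0) := by
    rw [hend, h0]
    simp
  constructor
  · have := h.turning_le b hb hend'
    rw [hE] at this
    simpa [startAngle] using this
  · rintro rfl
    have hm : m ≠ 0 := by
      rintro rfl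
      have e : w (0 + 1) = w 0 + stepVec w 0 := by simp [stepVec]
      rw [hend, h0, hE] at e
      simp at e
    have := h.turning_of_avoids le_rfl hend' (fun _ _ _ b hb hb' => by omega) (by omega)
    simpa [hE] using this

/-- If the last segment of a chain heads west and ends on the negative `x`-axis, then the preceding
segments form a chain that ends on the negative `x`-axis, closer to the origin. -/
theorem Realizes.exists_lt_of_last_west {τ : List Turn} {T : Turn} {v : ℕ → ℤ × ℤ}
    (h : Realizes (τ ++ [T]) v) {a : ℕ}
    (hend : v ((τ ++ [T]).length + 1) = (-(a : ℤ), 0))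
    (hW : segmentDir (τ ++ [T]) (τ ++ [T]).length = (-1, 0)) :
    ∃ b : ℕ, 1 ≤ b ∧ b < a ∧ v (τ.length + 1) = (-(b : ℤ), 0) := by
  obtain ⟨len, hlen, e⟩ := h.step _ le_rfl
  rw [hW, hend] at e
  have hn : (τ ++ [T]).length = τ.length + 1 := by simp
  have e' : v (τ.length + 1) = ((len : ℤ) - a, 0) := by
    rw [← hn, ← sub_eq_of_eq_add e]
    ext <;> simp
    ring
  rcases Nat.lt_or_ge len a with hla | hla
  · exact ⟨a - len, by omega, by omega, by rw [e', Nat.cast_sub hla.le]; simp⟩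
  -- Otherwise the last segment passes through the origin; simplicity then makes it segment `1` with
  -- the origin as its start, so segment `0` has length `0`.
  · exfalso
    have m0 : toPlane (0, 0) ∈ chainSegment v 0 := by
      rw [chainSegment, h.start]
      exact left_mem_segment _ _ _
    have mn : toPlane (0, 0) ∈ chainSegment v (τ.length + 1) := by
      have := toPlane_add_nsmul_mem_segment (v (τ.length + 1)) (-1, 0) (Nat.sub_le len a) hlen
      have hz : v (τ.length + 1) + (len - a) • (-1, 0) = (0, 0) := by
        rw [e']
        ext <;> simp [Nat.cast_sub hla]
      have hl : v (τ.length + 1) + len • (-1, 0) = v (τ.length + 1 + 1) := by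
        rw [← hn, hend, e]
      rwa [hz, hl] at this
    obtain ⟨h1, h2⟩ := h.simple 0 (τ.length + 1) (by omega) hn.ge _ ⟨m0, mn⟩
    have h2 := toPlane_injective h2
    obtain ⟨len0, hlen0, e0⟩ := h.step 0 (Nat.zero_le _)
    have hdir : segmentDir (τ ++ [T]) 0 = (1, 0) := rfl
    rw [← h1, ← h2, h.start, hdir] at e0
    simp at e0
    omega

/-- The lower bound for the distance of a point of the negative `x`-axis reachable by a turn
sequence. -/
theorem lower_bound_of_mem_negXDistances {σ : List Turn} {t : ℤ} (hσ : netTurn σ = t) (ht : 0 ≤ t)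
    {a : ℕ} (ha : a ∈ negXDistances σ) :
    (t % 4 = 0 ∨ t % 4 = 1 → |(t + 2) / 4 - 1| + 1 ≤ (a : ℤ)) ∧
    (t % 4 = 2 → σ.getLast? = some Turn.L → |(t + 2) / 4 - 2| + 2 ≤ (a : ℤ)) ∧
    (t % 4 = 2 → σ.getLast? = some Turn.R → (t + 2) / 4 + 1 ≤ (a : ℤ)) ∧
    (t % 4 = 3 → (t + 2) / 4 ≤ (a : ℤ)) := by
  obtain ⟨ha0, v, hv, hend⟩ := ha
  obtain ⟨w, m, hw, hw0, hwm, hE, hlast, hturn, -⟩ := hv.exists_isLatticePath _ le_rfl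
  obtain ⟨h1, h2⟩ := hw.turning_bounds hw0 hE ha0 (hwm.trans hend)
  rw [hlast, hturn] at h1 h2
  have hdir : segmentDir σ σ.length = quarterDir t := by
    rw [segmentDir_eq, List.take_length, hσ]
  rw [hdir, List.take_length, hσ] at h1 h2
  -- For `t ≡ 2` the last direction is west, and the bounds are applied to the chain without its
  -- last segment, of net turning `s = t ∓ 1`.
  have last (h4 : t % 4 = 2) (T : Turn) (hT : σ.getLast? = some T) : ∃ b : ℕ, ∃ s : ℤ, 1 ≤ b ∧
      b < a ∧ s + (if T = Turn.L then 1 else -1) = t ∧ s ≤ 4 * b + endAngle (quarterDir s) ∧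
      (b = 1 → s = 4 + (quarterDir s).2 ∨ s = -4 + (quarterDir s).2) := by
    obtain ⟨τ, rfl⟩ := List.getLast?_eq_some_iff.mp hT
    have hW : quarterDir t = (-1, 0) := by simp [quarterDir, h4]
    obtain ⟨b, hb, hba, hvb⟩ := hv.exists_lt_of_last_west hend (hdir.trans hW)
    obtain ⟨w, m, hw, hw0, hwm, hE, hlast, hturn, -⟩ :=
      hv.exists_isLatticePath τ.length (by simp)
    obtain ⟨h1, h2⟩ := hw.turning_bounds hw0 hE hb (hwm.trans hvb)
    rw [segmentDir_eq, List.take_left' rfl] at hlast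
    rw [hlast, hturn, List.take_left' rfl] at h1 h2
    refine ⟨b, netTurn τ, hb, hba, ?_, h1, h2⟩
    cases T
    · simpa [netTurn_append_L] using hσ
    · simpa [netTurn_append_R, sub_eq_add_neg] using hσ
  refine ⟨fun h4 => ?_, fun h4 hT => ?_, fun h4 hT => ?_, fun h4 => ?_⟩
  · rcases h4 with h4 | h4
    · simp only [quarterDir, h4, endAngle] at h1 h2
      norm_num at h1 h2
      -- The inequality settles `t ≥ 4`; for `t = 0` the clause about distance `1` excludes `a = 1`.
      rcases abs_cases ((t + 2) / 4 - 1) with h | h <;> omega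
    · simp only [quarterDir, h4, endAngle] at h1 h2
      norm_num at h1 h2
      rcases abs_cases ((t + 2) / 4 - 1) with h | h <;> omega
  · obtain ⟨b, s, hb, hba, hs, h1, h2⟩ := last h4 _ hT
    have hs : s + 1 = t := by simpa using hs
    have h5 : s % 4 = 1 := by omega
    simp only [quarterDir, h5, endAngle] at h1 h2
    norm_num at h1 h2
    rcases abs_cases ((t + 2) / 4 - 2) with h | h <;> omega
  · obtain ⟨b, s, hb, hba, hs, h1, h2⟩ := last h4 _ hT
    have hs : s + -1 = t := by simpa using hs
    have h5 : s % 4 = 3 := by omega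
    simp only [quarterDir, h5, endAngle] at h1
    norm_num at h1
    omega
  · simp only [quarterDir, h4, endAngle] at h1
    norm_num at h1
    omega

/-! ### Passing to the maximum -/

theorem finite_setOf_count_eq (l r : ℕ) :
    {σ : List Turn | σ.count Turn.L = l ∧ σ.count Turn.R = r}.Finite := by
  have : Finite Turn := Finite.of_injective (fun t : Turn => decide (t = Turn.L)) (by
    intro s t
    cases s <;> cases t <;> simp)
  refine (List.finite_length_eq Turn (l + r)).subset ?_
  rintro σ ⟨rfl, rfl⟩
  induction σ with
  | nil => rfl
  | cons t σ ih =>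
    simp only [Set.mem_ofPred_eq, List.length_cons] at ih ⊢
    cases t <;> simp <;> omega

/-- Finiteness is essential: `sSup` of an unbounded set of naturals would be `0`. -/
theorem xMinus_le_xMinusMax {σ : List Turn} (h : ReachesNegX σ) :
    xMinus σ ≤ xMinusMax (σ.count Turn.L) (σ.count Turn.R) := by
  refine le_csSup (Set.Finite.bddAbove ?_) ⟨σ, rfl, rfl, h, rfl⟩
  refine ((finite_setOf_count_eq (σ.count Turn.L) (σ.count Turn.R)).image xMinus).subset ?_
  rintro _ ⟨τ, h1, h2, -, rfl⟩
  exact ⟨τ, ⟨h1, h2⟩, rfl⟩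

theorem theorem7 (l r : ℕ) (hlr : r ≤ l) (σ : List Turn)
    (hl : σ.count Turn.L = l) (hr : σ.count Turn.R = r) (hreach : ReachesNegX σ) :
    (((l : ℤ) - r) % 4 = 0 ∨ ((l : ℤ) - r) % 4 = 1 →
      |((l : ℤ) - r + 2) / 4 - 1| + 1 ≤ (xMinus σ : ℤ) ∧
      |((l : ℤ) - r + 2) / 4 - 1| + 1 ≤ (xMinusMax l r : ℤ)) ∧
    (((l : ℤ) - r) % 4 = 2 → σ.getLast? = some Turn.L →
      |((l : ℤ) - r + 2) / 4 - 2| + 2 ≤ (xMinus σ : ℤ) ∧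
      |((l : ℤ) - r + 2) / 4 - 2| + 2 ≤ (xMinusMax l r : ℤ)) ∧
    (((l : ℤ) - r) % 4 = 2 → σ.getLast? = some Turn.R →
      ((l : ℤ) - r + 2) / 4 + 1 ≤ (xMinus σ : ℤ) ∧
      ((l : ℤ) - r + 2) / 4 + 1 ≤ (xMinusMax l r : ℤ)) ∧
    (((l : ℤ) - r) % 4 = 3 →
      ((l : ℤ) - r + 2) / 4 ≤ (xMinus σ : ℤ) ∧
      ((l : ℤ) - r + 2) / 4 ≤ (xMinusMax l r : ℤ)) := by
  subst hl hr
  obtain ⟨h1, h2, h3, h4⟩ := lower_bound_of_mem_negXDistances (σ := σ) rfl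
    (by rw [netTurn]; omega) (Nat.sInf_mem hreach)
  have hmax : (xMinus σ : ℤ) ≤ xMinusMax (σ.count Turn.L) (σ.count Turn.R) := by
    exact_mod_cast xMinus_le_xMinusMax hreach
  exact ⟨fun h => ⟨h1 h, (h1 h).trans hmax⟩, fun h hT => ⟨h2 h hT, (h2 h hT).trans hmax⟩,
    fun h hT => ⟨h3 h hT, (h3 h hT).trans hmax⟩, fun h => ⟨h4 h, (h4 h).trans hmax⟩⟩
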